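/- Let $p\ge 2$ be a prime, put $n=4$ if $p=2$ and $n=p$ otherwise, and let $X=\{v_0,v_1,\dots,v_n,e_{1,2},e_{2,3},\dots,e_{n-1,n},e_{n,1}\}$ be a set of $2n+1$ variables. Put $m=\prod_{y\in X}y$, and let $I=I(p)$ be the monomial ideal generated by $$m_0=\frac{m}{v_0},\qquad m_i=\frac{v_0\,m}{e_{i-1,i}\,v_i\,e_{i,i+1}}\quad(1\le i\le n),$$ the indices $1,\dots,n$ being read cyclically. Let $G_I$ be the group of all permutations of $X$ that preserve the set of monomials in $I$. Let $\Bbbk'$ be any algebraic field extension of $\mathbb F_p$, and put $R'=\Bbbk'[X]$ with its standard $\mathbb Z$-grading, and $\mathfrak m=(X)$. Given an action of $G_I$ on $\Bbbk'$ by field automorphisms over $\mathbb F_p$, each $\sigma\in G_I$ acts on $R'$ as a ring automorphism, by permuting the variables and acting on the coefficients. For a subgroup $C\le G_I$, a *$C$-equivariant minimal resolution* consists of a chain complex $\mathfrak M=(M_0\xleftarrow{\mu_1}M_1\xleftarrow{\mu_2}M_2\leftarrow\cdots)$ of finite free $R'$-modules, exact in positive degrees, with $\mu_j(M_j)\subseteq\mathfrak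 m M_{j-1}$ for all $j\ge1$, and a group homomorphism $\mathfrak M(-)$ from $C$ to the group of $\mathbb F_p$-linear automorphisms of the complex $\mathfrak M$, such that 1. there are integers $\beta_{j,d}\ge 0$ and isomorphisms of $R'$-modules $\theta_j\colon M_j\to\bigoplus_{d\in\mathbb Z}R'(-d)^{\beta_{j,d}}$ for $j\ge0$ and $\epsilon\colon \mathrm H_0(\mathfrak M)\to IR'$ such that each $\theta_{j-1}\mu_j\theta_j^{-1}$ with $j\ge1$ preserves degrees and $\epsilon$ preserves degrees for the grading of $\mathrm H_0(\mathfrak M)$ induced by $\theta_0$; 2. for each $\sigma\in C$ the automorphism $\mathfrak M(\sigma)$ is $\sigma$-semilinear, i.e. $\mathfrak M(\sigma)(rx)=\sigma(r)\,\mathfrak M(\sigma)(x)$ for $r\in R'$, and there is an isomorphism of $R'$-modules $\delta\colon \mathrm H_0(\mathfrak M)\to IR'$ such that $\sigma\delta=\delta\bar\sigma$ for all $\sigma\in C$, where $\bar\sigma$ is the map that $\mathfrak M(\sigma)$ induces on $\mathrm H_0(\mathfrak M)$. Then for no action of $G_I$ on $\Bbbk'$ by field automorphisms over $\mathbb F_p$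 does there exist a $G_I$-equivariant minimal resolution. Moreover, for no such action does there exist a $C$-equivariant minimal resolution, where $C\le G_I$ is the cyclic group generated by the rotation $v_0\mapsto v_0$, $v_i\mapsto v_{i+1}$, $e_{i,i+1}\mapsto e_{i+1,i+2}$. -/

import Mathlib

universe w u

/-! ### Monomial ideals and their symmetries

The free abelian monoid `M(X)` is `X →₀ ℕ`, written additively, and a monomial ideal is an ideal of
this monoid, i.e. a term of `AddSemigroupIdeal (X →₀ ℕ)`. -/

namespace MonomialIdeal

/-- The group of all permutations of the variables whose induced automorphism of the monoid `M(X)`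
preserves the monomial ideal `I`. (Every automorphism of the monoid `M(X)` is induced by a unique
permutation of `X`.) -/
def symmetryGroup {X : Type*} (I : AddSemigroupIdeal (X →₀ ℕ)) : Subgroup (Equiv.Perm X) where
  carrier := {σ | ∀ u : X →₀ ℕ, u.mapDomain σ ∈ I ↔ u ∈ I}
  one_mem' u := by simp [Finsupp.mapDomain_id]
  mul_mem' {σ τ} hσ hτ u := by
    rw [Equiv.Perm.coe_mul, Finsupp.mapDomain_comp, hσ, hτ]
  inv_mem' {σ} hσ u := by
    rw [← hσ (u.mapDomain _), ← Finsupp.mapDomain_comp, ← Equiv.Perm.coe_mul]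
    simp [Finsupp.mapDomain_id]

/-- The ideal `I K[X]` of the polynomial ring that is generated by the monomials in `I`. -/
noncomputable def polyIdeal {X : Type*} (I : AddSemigroupIdeal (X →₀ ℕ)) (K : Type*) [Field K] :
    Ideal (MvPolynomial X K) :=
  Ideal.span ((fun u => MvPolynomial.monomial u (1 : K)) '' (I : Set (X →₀ ℕ)))

end MonomialIdeal

/-! ### Gradings -/

/-- The degree `e` homogeneous component, for `e : ℤ`, of the polynomial ring `K[X]` with its
standard grading; it is zero for negative `e`. -/
noncomputable def polyComponent (X K : Type*) [Field K] : ℤ → Submodule K (MvPolynomial X K)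
  | Int.ofNat m => MvPolynomial.homogeneousSubmodule X K m
  | Int.negSucc _ => ⊥

/-- The underlying module of `⨁_d K[X](-d)^(β d)`. -/
abbrev TwistedFree (X K : Type*) [Field K] (β : ℤ → ℕ) : Type _ :=
  (Σ d : ℤ, Fin (β d)) →₀ MvPolynomial X K

/-- The degree `e` homogeneous component of `⨁_d K[X](-d)^(β d)`: in the summands `K[X](-d)` it
consists of the polynomials of degree `e - d`. -/
def twistedComponent (X K : Type*) [Field K] (β : ℤ → ℕ) (e : ℤ) :
    Submodule K (TwistedFree X K β) where
  carrier := {f | ∀ j, f j ∈ polyComponent X K (e - j.1)}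
  add_mem' hf hg j := add_mem (hf j) (hg j)
  zero_mem' j := zero_mem (polyComponent X K (e - j.1))
  smul_mem' c _ hf j := Submodule.smul_mem _ c (hf j)

/-! ### Minimal free resolutions with a lift of the symmetries -/

/-- The ring automorphism of `K[X]` that acts on the coefficients by the field automorphism `a` and
permutes the variables by `σ`. -/
noncomputable def polyAut {X k K : Type*} [Field k] [Field K] [Algebra k K]
    (a : K ≃ₐ[k] K) (σ : Equiv.Perm X) : MvPolynomial X K ≃+* MvPolynomial X K :=
  (MvPolynomial.mapEquiv X (a : K ≃+* K)).trans
    (MvPolynomial.renameEquiv K σ : MvPolynomial X K ≃ₐ[K] MvPolynomial X K)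

/-- Zeroth homology of a chain complex `M₀ ← M₁ ← ⋯` of modules: the cokernel of `M₁ → M₀`. -/
abbrev zerothHomology {R : Type*} [Ring R] (M : ChainComplex (ModuleCat R) ℕ) : Type _ :=
  M.X 0 ⧸ LinearMap.range (M.d 1 0).hom

open MonomialIdeal in
/-- Let `I` be a monomial ideal, and let a group `Γ` act on the variables through symmetries of `I`
(via `π`) and on the extension field `K` of `k` by field automorphisms over `k` (via `a`); together
these give the action of `Γ` on `K[X]` by the ring automorphisms `polyAut (a γ) (π γ)`.
A term of this structure is a minimal free resolution of `I K[X]`, isomorphic to a graded one,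
together with a lift of the action of `Γ`. -/
structure EquivariantMinimalResolution {X k : Type*} {K : Type u} {Γ : Type*} [Field k] [Field K] [Algebra k K] [Group Γ]
    (I : AddSemigroupIdeal (X →₀ ℕ)) (π : Γ →* symmetryGroup I) (a : Γ →* (K ≃ₐ[k] K)) where
  /-- The chain complex. -/
  M : ChainComplex (ModuleCat.{w} (MvPolynomial X K)) ℕ
  /-- Its terms are finite free modules. -/
  free : ∀ n, Module.Free (MvPolynomial X K) (M.X n)
  finite : ∀ n, Module.Finite (MvPolynomial X K) (M.X n)
  /-- It is acyclic, i.e. exact in all positive degrees. -/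
  exact : ∀ n, Function.Exact (M.d (n + 2) (n + 1)).hom (M.d (n + 1) n).hom
  /-- It is minimal: `M.d` maps into `𝔪 M`, with `𝔪` generated by the variables. -/
  minimal : ∀ n, LinearMap.range (M.d (n + 1) n).hom ≤
    Ideal.span (Set.range (MvPolynomial.X : X → MvPolynomial X K)) •
      (⊤ : Submodule (MvPolynomial X K) (M.X n))
  /-- The graded Betti numbers `β n d`. -/
  β : ℕ → ℤ → ℕ
  /-- Module isomorphisms that make `M` a complex of graded modules and degree-preserving maps. -/
  θ : ∀ n, M.X n ≃ₗ[MvPolynomial X K] TwistedFree X K (β n)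
  θ_graded : ∀ n e, ∀ x ∈ twistedComponent X K (β (n + 1)) e,
    θ n ((M.d (n + 1) n).hom ((θ (n + 1)).symm x)) ∈ twistedComponent X K (β n) e
  /-- An isomorphism of the zeroth homology with the ideal, which is degree-preserving for the
  grading induced by `θ 0`. -/
  ε : zerothHomology M ≃ₗ[MvPolynomial X K] polyIdeal I K
  ε_graded : ∀ e, ∀ x ∈ twistedComponent X K (β 0) e,
    (ε (Submodule.Quotient.mk ((θ 0).symm x)) : MvPolynomial X K) ∈ polyComponent X K e
  /-- The action of `Γ` on the complex, by automorphisms that commute with the differentials. -/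
  act : Γ → ∀ n, M.X n ≃+ M.X n
  act_one : ∀ n (x : M.X n), act 1 n x = x
  act_mul : ∀ γ γ' n (x : M.X n), act (γ * γ') n x = act γ n (act γ' n x)
  act_comm : ∀ γ n (x : M.X (n + 1)),
    act γ n ((M.d (n + 1) n).hom x) = (M.d (n + 1) n).hom (act γ (n + 1) x)
  /-- Each `γ` acts as a morphism from `M` to its restriction of scalars along the automorphism of
  `K[X]` given by `γ`. As that automorphism fixes `k`, the action is in particular `k`-linear,
  see `EquivariantMinimalResolution.act_smul_base`. -/
  act_smul : ∀ γ n (r : MvPolynomial X K) (x : M.X n),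
    act γ n (r • x) = polyAut (a γ) (π γ : Equiv.Perm X) r • act γ n x
  /-- An isomorphism of the zeroth homology with the ideal, which is not required to be
  degree-preserving, under which the action on homology induced by `act` becomes the action of `Γ`
  on the ideal. -/
  δ : zerothHomology M ≃ₗ[MvPolynomial X K] polyIdeal I K
  δ_equivariant : ∀ γ (x : M.X 0),
    (δ (Submodule.Quotient.mk (act γ 0 x)) : MvPolynomial X K) =
      polyAut (a γ) (π γ : Equiv.Perm X) (δ (Submodule.Quotient.mk x) : MvPolynomial X K)

theorem EquivariantMinimalResolution.act_smul_base {X k : Type*} {K : Type u} {Γ : Type*} [Field k] [Field K]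
    [Algebra k K] [Group Γ] {I : AddSemigroupIdeal (X →₀ ℕ)}
    {π : Γ →* MonomialIdeal.symmetryGroup I} {a : Γ →* (K ≃ₐ[k] K)}
    (S : EquivariantMinimalResolution.{w} I π a) (γ : Γ) (n : ℕ) (c : k) (x : S.M.X n) :
    S.act γ n (algebraMap k (MvPolynomial X K) c • x) =
      algebraMap k (MvPolynomial X K) c • S.act γ n x := by
  rw [S.act_smul]
  congr 1
  simp [polyAut, MvPolynomial.algebraMap_eq, IsScalarTower.algebraMap_apply k K (MvPolynomial X K)]

/-- A symmetric minimal free resolution of the monomial ideal `I` with base field `k` and extension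
field `K`: an action of the full symmetry group of `I` on `K` by field automorphisms over `k`, and a
minimal free resolution of `I K[X]` to which the action of that group lifts. -/
structure SymmetricMinimalResolution {X : Type*} (k : Type*) (K : Type u) [Field k] [Field K] [Algebra k K]
    (I : AddSemigroupIdeal (X →₀ ℕ)) where
  fieldAction : MonomialIdeal.symmetryGroup I →* (K ≃ₐ[k] K)
  resolution : EquivariantMinimalResolution.{w} I (MonoidHom.id (MonomialIdeal.symmetryGroup I))
    fieldAction

/-! ### The ideal `I(p)` -/

namespace CycleIdeal

/-- The variables `v₀`, `v i` and `e i` with `i` in `ℤ/n`. Here `ℤ/n` stands for the cyclically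
ordered indices `1, …, n`, and `e i` is the variable `e_{i,i+1}` (so `e n` is `e_{n,1}`). -/
inductive Var (n : ℕ) : Type
  | v₀ : Var n
  | v : ZMod n → Var n
  | e : ZMod n → Var n

/-- `Var n` as a disjoint union. -/
def Var.equivSum (n : ℕ) : Var n ≃ Option (ZMod n ⊕ ZMod n) where
  toFun
    | v₀ => none
    | v i => some (Sum.inl i)
    | e i => some (Sum.inr i)
  invFun
    | none => v₀
    | some (Sum.inl i) => v i
    | some (Sum.inr i) => e i
  left_inv x := by cases x <;> rfl
  right_inv x := by rcases x with _ | x | x <;> rfl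

instance (n : ℕ) [NeZero n] : Finite (Var n) := Finite.of_equiv _ (Var.equivSum n).symm

theorem card_var (n : ℕ) [NeZero n] : Nat.card (Var n) = 2 * n + 1 := by
  rw [Nat.card_congr (Var.equivSum n), Finite.card_option, Nat.card_sum, Nat.card_zmod]
  ring

/-- The product `m` of all variables. -/
noncomputable def m (n : ℕ) [NeZero n] : Var n →₀ ℕ := Finsupp.equivFunOnFinite.symm fun _ => 1

/-- The monomial `m₀ = m / v₀`. -/
noncomputable def m₀ (n : ℕ) [NeZero n] : Var n →₀ ℕ := m n - Finsupp.single Var.v₀ 1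

/-- The monomial `mᵢ = v₀ m / (e_{i-1,i} v_i e_{i,i+1})`. The division is exact for `n ≥ 2`. -/
noncomputable def mᵢ (n : ℕ) [NeZero n] (i : ZMod n) : Var n →₀ ℕ :=
  Finsupp.single Var.v₀ 1 + m n -
    (Finsupp.single (Var.e (i - 1)) 1 + Finsupp.single (Var.v i) 1 + Finsupp.single (Var.e i) 1)

/-- The monomial ideal generated by `m₀, m₁, …, mₙ`. -/
noncomputable def ideal (n : ℕ) [NeZero n] : AddSemigroupIdeal (Var n →₀ ℕ) :=
  AddSemigroupIdeal.closure (insert (m₀ n) (Set.range (mᵢ n)))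

/-- The cyclic rotation `v₀ ↦ v₀`, `v_i ↦ v_{i+1}`, `e_{i,i+1} ↦ e_{i+1,i+2}`. -/
def rotationPerm (n : ℕ) : Equiv.Perm (Var n) where
  toFun
    | .v₀ => .v₀
    | .v i => .v (i + 1)
    | .e i => .e (i + 1)
  invFun
    | .v₀ => .v₀
    | .v i => .v (i - 1)
    | .e i => .e (i - 1)
  left_inv x := by cases x <;> simp
  right_inv x := by cases x <;> simp

theorem mapDomain_tsub {X : Type*} (σ : Equiv.Perm X) (u w : X →₀ ℕ) :
    (u - w).mapDomain σ = u.mapDomain σ - w.mapDomain σ := by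
  ext x
  obtain ⟨y, rfl⟩ := σ.surjective x
  simp [Finsupp.mapDomain_apply σ.injective]

theorem mapDomain_m {n : ℕ} [NeZero n] (σ : Equiv.Perm (Var n)) : (m n).mapDomain σ = m n := by
  ext x
  obtain ⟨y, rfl⟩ := σ.surjective x
  simp [Finsupp.mapDomain_apply σ.injective, m]

theorem mapDomain_mem_ideal {n : ℕ} [NeZero n] {σ : Equiv.Perm (Var n)}
    (h₀ : (m₀ n).mapDomain σ ∈ ideal n) (h : ∀ i, (mᵢ n i).mapDomain σ ∈ ideal n)
    {u : Var n →₀ ℕ} (hu : u ∈ ideal n) : u.mapDomain σ ∈ ideal n := by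
  obtain ⟨w, z, hz, rfl⟩ := AddSemigroupIdeal.mem_closure''.1 hu
  rw [Finsupp.mapDomain_add]
  refine AddSemigroupIdeal.add_mem _ _ ?_
  rcases hz with rfl | ⟨i, rfl⟩
  exacts [h₀, h i]

theorem rotationPerm_mem (n : ℕ) [NeZero n] :
    rotationPerm n ∈ MonomialIdeal.symmetryGroup (ideal n) := by
  have h₀ : m₀ n ∈ ideal n := AddSemigroupIdeal.mem_closure_of_mem (Set.mem_insert _ _)
  have h (i : ZMod n) : mᵢ n i ∈ ideal n :=
    AddSemigroupIdeal.mem_closure_of_mem (Set.mem_insert_of_mem _ (Set.mem_range_self i))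
  intro u
  constructor
  · intro hu
    have key := mapDomain_mem_ideal (σ := (rotationPerm n)⁻¹) ?_ ?_ hu
    · rwa [← Finsupp.mapDomain_comp, ← Equiv.Perm.coe_mul, inv_mul_cancel, Equiv.Perm.coe_one,
        Finsupp.mapDomain_id] at key
    · rw [m₀, mapDomain_tsub, mapDomain_m, Finsupp.mapDomain_single]
      exact h₀
    · intro i
      rw [mᵢ, mapDomain_tsub, Finsupp.mapDomain_add, Finsupp.mapDomain_add, Finsupp.mapDomain_add,
        mapDomain_m]
      simp only [Finsupp.mapDomain_single]
      exact h (i - 1)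
  · refine mapDomain_mem_ideal ?_ ?_
    · rw [m₀, mapDomain_tsub, mapDomain_m, Finsupp.mapDomain_single]
      exact h₀
    · intro i
      rw [mᵢ, mapDomain_tsub, Finsupp.mapDomain_add, Finsupp.mapDomain_add, Finsupp.mapDomain_add,
        mapDomain_m]
      simp only [Finsupp.mapDomain_single]
      have e : rotationPerm n (Var.e (i - 1)) = Var.e (i + 1 - 1) := by
        simp [rotationPerm]
      rw [e]
      exact h (i + 1)

/-- The cyclic rotation as a symmetry of the ideal. -/
noncomputable def rotation (n : ℕ) [NeZero n] : MonomialIdeal.symmetryGroup (ideal n) :=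
  ⟨rotationPerm n, rotationPerm_mem n⟩

/-- The number `n(p)`. -/
def nOf (p : ℕ) : ℕ := if p = 2 then 4 else p

instance (p : ℕ) [h : Fact p.Prime] : NeZero (nOf p) :=
  ⟨by have := h.out.ne_zero; unfold nOf; split <;> omega⟩

/-- The ideal `I(p)`. -/
noncomputable abbrev idealOf (p : ℕ) [Fact p.Prime] : AddSemigroupIdeal (Var (nOf p) →₀ ℕ) :=
  ideal (nOf p)

end CycleIdeal

open Finset

/-! ### Automorphisms of algebraic extensions of finite fields -/

/-! Near the origin a minimal resolution of the ideal looks like an `n`-gon with a whisker. Its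
vertices are the generators, its boundary edges are syzygies `f_i` between `mᵢ` and `mᵢ₊₁`, one more
edge `g` joins `m₀` to a single `mᵢ`, and the 2-cell has boundary `q = ∑ e_i f_i`. The rotation has
to move the whisker, and averaging `g` over its orbit would require dividing by `n`, which is zero
in characteristic `p`.

Let `S` be the lift of the rotation, `τ` its action on the ring and `α` its action on the field. The
`f_i` can be chosen as one `S`-orbit, so `S` fixes `q`. Choose `c` over `m₀` and write `S c - c = d
y`; then `S g - g = v₀² y + e_0 f_0 + κ` with `d κ = 0`. Summed over the orbit, the left side
telescopes to zero because `S^n = 1`, and `e_0 f_0` contributes `q`. Up to an invariant factor `ρ`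
with constant term 1, cycles are multiples of `q`. Comparing coefficients of `q` gives `v₀² w + ρ +
∑ τ^k t = 0`, so at the origin `1 + ∑ α^k(t(0)) = 0`. This is `not_exists_equivariant_presentation`.

These orbit sums vanish by `sum_fieldAction_rotation`: the reflection inverts the rotation, and
automorphisms of an algebraic extension of the prime field commute, so `α² = 1`.

The equivariant identification of homology with the ideal need not preserve degrees, so the lifts
need not be homogeneous. They are controlled only near the origin, through Nakayama's lemma and
multipliers `r` with constant term 1. -/

theorem AlgEquiv.commute_of_isAlgebraic_zmod {p : ℕ} [Fact p.Prime] {K : Type*} [Field K]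
    [Algebra (ZMod p) K] [Algebra.IsAlgebraic (ZMod p) K] (f g : K ≃ₐ[ZMod p] K) :
    f * g = g * f := by
  ext x
  -- The simple extension generated by `x` is a finite field, hence normal with abelian Galois
  -- group.
  let F := IntermediateField.adjoin (ZMod p) {x}
  have : FiniteDimensional (ZMod p) F :=
    IntermediateField.adjoin.finiteDimensional (Algebra.IsIntegral.isIntegral x)
  have : Finite F := Module.finite_of_finite (ZMod p)
  let y : F := ⟨x, IntermediateField.mem_adjoin_simple_self _ x⟩
  have h := DFunLike.congr_fun
    (IsMulCommutative.is_comm.comm (f.restrictNormal F) (g.restrictNormal F)) y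
  have h' := congrArg (algebraMap F K) h
  simp only [AlgEquiv.mul_apply, AlgEquiv.restrictNormal_commutes] at h'
  exact h'

/-! ### Nakayama's lemma and independence at the origin of affine space -/

namespace MvPolynomial

theorem mem_span_range_X_iff {X : Type*} {R : Type*} [CommRing R] (p : MvPolynomial X R) :
    p ∈ Ideal.span (Set.range (MvPolynomial.X : X → MvPolynomial X R)) ↔
      constantCoeff p = 0 := by
  rw [← Set.image_univ, mem_ideal_span_X_image, constantCoeff_eq, ← notMem_support_iff]
  constructor
  · intro h h0
    obtain ⟨i, -, hi⟩ := h 0 h0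
    exact hi rfl
  · intro h m hm
    by_contra! h'
    exact h (by convert hm; ext i; simpa using (h' i trivial).symm)

/-- Nakayama at the origin without localising: the multiplier `r` is a unit in the local ring there.
-/
theorem exists_smul_mem_of_le_sup {X R M : Type*} [CommRing R] [AddCommGroup M]
    [Module (MvPolynomial X R) M] [Module.Finite (MvPolynomial X R) M]
    (N : Submodule (MvPolynomial X R) M)
    (h : ⊤ ≤ N ⊔ Ideal.span (Set.range (MvPolynomial.X : X → MvPolynomial X R)) •
      (⊤ : Submodule (MvPolynomial X R) M)) :
    ∃ r : MvPolynomial X R, constantCoeff r = 1 ∧ ∀ x, r • x ∈ N := by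
  obtain ⟨r, hr, hN⟩ := Submodule.exists_sub_one_mem_and_smul_le_of_fg_of_le_sup
    (Module.Finite.fg_top (R := MvPolynomial X R) (M := M)) le_top h
  rw [mem_span_range_X_iff, map_sub, map_one, sub_eq_zero] at hr
  exact ⟨r, hr, fun x => hN (Submodule.smul_mem_pointwise_smul x r ⊤ trivial)⟩

/-- A family in a free module over a polynomial ring over a field is linearly independent when it is
so at the origin. -/
theorem linearIndependent_of_origin {X K M ι : Type*} [Field K] [AddCommGroup M] [Fintype ι]
    [Module (MvPolynomial X K) M] [Module.Finite (MvPolynomial X K) M]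
    [Module.Free (MvPolynomial X K) M] (b : ι → M)
    (h : ∀ c : ι → K, ∑ i, (C (c i) : MvPolynomial X K) • b i ∈
      Ideal.span (Set.range (MvPolynomial.X : X → MvPolynomial X K)) •
        (⊤ : Submodule (MvPolynomial X K) M) → c = 0) :
    LinearIndependent (MvPolynomial X K) b := by
  classical
  let B := Module.Free.chooseBasis (MvPolynomial X K) M
  let A : Matrix ι (Module.Free.ChooseBasisIndex (MvPolynomial X K) M) (MvPolynomial X K) :=
    Matrix.of fun i k => B.repr (b i) k
  let A₀ := A.map (constantCoeff : MvPolynomial X K →+* K)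
  have hA₀ : LinearIndependent K A₀.row := by
    rw [Fintype.linearIndependent_iff]
    intro c hc
    have := h c (by
      rw [← B.sum_repr (∑ i, (C (c i) : MvPolynomial X K) • b i)]
      refine Submodule.sum_mem _ fun k _ => Submodule.smul_mem_smul ?_ trivial
      rw [mem_span_range_X_iff]
      have := congrFun hc k
      simpa [A₀, A, map_sum, Finset.sum_apply] using this)
    exact congrFun this
  -- Independent rows over a field give a right inverse; lifted to constant polynomials, it makes `A
  -- * Q` a square matrix whose determinant is 1 at the origin.
  obtain ⟨Q, hQ⟩ : ∃ Q : Matrix (Module.Free.ChooseBasisIndex (MvPolynomial X K) M) ι K,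
      A₀ * Q = 1 := by
    rw [← Matrix.vecMul_injective_iff] at hA₀
    obtain ⟨g, hg⟩ := LinearMap.exists_leftInverse_of_injective (Matrix.mulVecLin A₀.transpose) (by
      rw [LinearMap.ker_eq_bot]
      intro x y hxy
      exact hA₀ (by simpa [Matrix.mulVec_transpose] using hxy))
    refine ⟨(LinearMap.toMatrix' g).transpose, Matrix.transpose_injective ?_⟩
    rw [Matrix.transpose_mul, Matrix.transpose_transpose, Matrix.transpose_one,
      ← LinearMap.toMatrix'_id, ← hg, LinearMap.toMatrix'_comp, ← Matrix.toLin'_apply',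
      LinearMap.toMatrix'_toLin']
  have hdet : (A * Q.map (C : K →+* MvPolynomial X K)).det ≠ 0 := by
    intro h0
    have := congrArg (constantCoeff : MvPolynomial X K →+* K) h0
    rw [RingHom.map_det, map_zero, RingHom.mapMatrix_apply, Matrix.map_mul, Matrix.map_map] at this
    have e : (⇑(constantCoeff : MvPolynomial X K →+* K) ∘ ⇑(C : K →+* MvPolynomial X K)) = id := by
      ext; simp
    rw [e, Matrix.map_id] at this
    change (A₀ * Q).det = 0 at this
    simp [hQ] at this
  rw [Fintype.linearIndependent_iff]
  intro a ha
  refine congrFun (Matrix.eq_zero_of_vecMul_eq_zero hdet ?_)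
  rw [← Matrix.vecMul_vecMul]
  have : Matrix.vecMul a A = 0 := by
    ext1 k
    have := congrArg (fun x => B.repr x k) ha
    simpa [Matrix.vecMul, dotProduct, A] using this
  rw [this, Matrix.zero_vecMul]

end MvPolynomial

theorem Function.IsPeriodicPt.iterate_zmod_val_add_one {α : Type*} {f : α → α} {n : ℕ} [NeZero n]
    {x : α} (h : Function.IsPeriodicPt f n x) (i : ZMod n) :
    f^[(i + 1).val] x = f (f^[i.val] x) := by
  rw [← Function.iterate_succ_apply' f, ← h.iterate_mod_apply (i.val + 1), ZMod.val_add,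
    ← h.iterate_mod_apply, Nat.mod_mod, ZMod.val_one_eq_one_mod, Nat.add_mod_mod]

theorem ZMod.sum_eq_sum_range {n : ℕ} [NeZero n] {M : Type*} [AddCommMonoid M] (F : ZMod n → M) :
    ∑ i, F i = ∑ k ∈ range n, F k := by
  refine (Finset.sum_nbij' (fun k : ℕ => (k : ZMod n)) ZMod.val ?_ ?_ ?_ ?_ ?_).symm
  · simp
  · simp [ZMod.val_lt]
  · intro k hk
    exact ZMod.val_cast_of_lt (mem_range.1 hk)
  · simp
  · simp

/-! ### Dihedral symmetries and orbit sums on the coefficients -/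

namespace CycleIdeal

/-- The reflection `v₀ ↦ v₀`, `v_i ↦ v_{-i}`, `e_{i,i+1} ↦ e_{-i-1,-i}`. -/
def reflectionPerm (n : ℕ) : Equiv.Perm (Var n) where
  toFun
    | .v₀ => .v₀
    | .v i => .v (-i)
    | .e i => .e (-i - 1)
  invFun
    | .v₀ => .v₀
    | .v i => .v (-i)
    | .e i => .e (-i - 1)
  left_inv x := by cases x <;> simp
  right_inv x := by cases x <;> simp

theorem mem_symmetryGroup_of_involutive {n : ℕ} [NeZero n] {σ : Equiv.Perm (Var n)}
    (hσ : σ * σ = 1) (h₀ : (m₀ n).mapDomain σ ∈ ideal n)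
    (h : ∀ i, (mᵢ n i).mapDomain σ ∈ ideal n) : σ ∈ MonomialIdeal.symmetryGroup (ideal n) := by
  refine fun u => ⟨fun hu => ?_, mapDomain_mem_ideal h₀ h⟩
  have key := mapDomain_mem_ideal h₀ h hu
  rwa [← Finsupp.mapDomain_comp, ← Equiv.Perm.coe_mul, hσ, Equiv.Perm.coe_one,
    Finsupp.mapDomain_id] at key

theorem reflectionPerm_mul_self (n : ℕ) : reflectionPerm n * reflectionPerm n = 1 :=
  Equiv.ext (reflectionPerm n).left_inv

theorem reflectionPerm_mem (n : ℕ) [NeZero n] :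
    reflectionPerm n ∈ MonomialIdeal.symmetryGroup (ideal n) := by
  refine mem_symmetryGroup_of_involutive (reflectionPerm_mul_self n) ?_ fun i => ?_
  · rw [m₀, mapDomain_tsub, mapDomain_m, Finsupp.mapDomain_single]
    exact AddSemigroupIdeal.mem_closure_of_mem (Set.mem_insert _ _)
  · rw [mᵢ, mapDomain_tsub, Finsupp.mapDomain_add, Finsupp.mapDomain_add, Finsupp.mapDomain_add,
      mapDomain_m]
    simp only [Finsupp.mapDomain_single]
    have e : reflectionPerm n (Var.e (i - 1)) = Var.e (-i) := by simp [reflectionPerm]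
    have h : mᵢ n (-i) ∈ ideal n :=
      AddSemigroupIdeal.mem_closure_of_mem (Set.mem_insert_of_mem _ (Set.mem_range_self _))
    rw [e, add_assoc (Finsupp.single (Var.e (-i)) 1), add_comm (Finsupp.single (Var.e (-i)) 1),
      add_comm (Finsupp.single (reflectionPerm n (Var.v i)) 1)]
    exact h

/-- The reflection as a symmetry of the ideal. -/
noncomputable def reflection (n : ℕ) [NeZero n] : MonomialIdeal.symmetryGroup (ideal n) :=
  ⟨reflectionPerm n, reflectionPerm_mem n⟩

theorem reflection_conj_rotation (n : ℕ) [NeZero n] :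
    reflection n * rotation n * reflection n * rotation n = 1 := by
  refine Subtype.ext (Equiv.ext fun x => ?_)
  change reflectionPerm n (rotationPerm n (reflectionPerm n (rotationPerm n x))) = x
  cases x <;> simp [reflectionPerm, rotationPerm]

theorem reflection_mul_self (n : ℕ) [NeZero n] : reflection n * reflection n = 1 :=
  Subtype.ext (reflectionPerm_mul_self n)

theorem rotationPerm_iterate (n k : ℕ) (x : Var n) :
    (rotationPerm n)^[k] x = match x with
      | .v₀ => .v₀
      | .v i => .v (i + k)
      | .e i => .e (i + k) := by
  induction k with
  | zero => cases x <;> simp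
  | succ k ih =>
    rw [Function.iterate_succ_apply', ih]
    cases x <;> simp [rotationPerm, add_assoc]

theorem rotation_pow (n : ℕ) [NeZero n] : rotation n ^ n = 1 := by
  refine Subtype.ext (Equiv.ext fun x => ?_)
  change (rotationPerm n ^ n) x = x
  rw [Equiv.Perm.coe_pow, rotationPerm_iterate]
  cases x <;> simp

section fieldAction

variable {p : ℕ} [Fact p.Prime] {K : Type u} [Field K] [Algebra (ZMod p) K]
  [Algebra.IsAlgebraic (ZMod p) K]

/-- The reflection conjugates the rotation to its inverse, and in a commutative image conjugate
elements agree. This uses the action of the whole symmetry group on the field, even when only the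
rotation is lifted. -/
theorem fieldAction_rotation_sq (n : ℕ) [NeZero n]
    (a : MonomialIdeal.symmetryGroup (ideal n) →* (K ≃ₐ[ZMod p] K)) :
    a (rotation n) ^ 2 = 1 := by
  have h := congrArg a (reflection_conj_rotation n)
  rw [map_mul, map_mul, map_mul, map_one,
    AlgEquiv.commute_of_isAlgebraic_zmod (a (reflection n)) (a (rotation n)), mul_assoc (a _),
    ← map_mul, reflection_mul_self, map_one, mul_one] at h
  rw [pow_two, h]

theorem sum_fieldAction_rotation
    (a : MonomialIdeal.symmetryGroup (idealOf p) →* (K ≃ₐ[ZMod p] K)) (c : K) :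
    ∑ k ∈ range (nOf p), (a (rotation (nOf p)))^[k] c = 0 := by
  have h2 := fieldAction_rotation_sq (nOf p) a
  have hn : a (rotation (nOf p)) ^ nOf p = 1 := by rw [← map_pow, rotation_pow, map_one]
  have : CharP K p := charP_of_injective_algebraMap (algebraMap (ZMod p) K).injective p
  by_cases hp : p = 2
  · have h4 : nOf p = 4 := by simp [nOf, hp]
    subst hp
    generalize a (rotation (nOf 2)) = α at h2
    have h (x : K) : α (α x) = x := DFunLike.congr_fun h2 x
    -- The four terms are `c, α c, c, α c`, so they cancel in characteristic 2.
    rw [h4]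
    simp only [sum_range_succ, Function.iterate_succ_apply', Function.iterate_zero_apply, h,
      range_zero, sum_empty, zero_add]
    rw [add_assoc, CharTwo.add_self_eq_zero]
  · have hodd : nOf p = p := by simp [nOf, hp]
    -- Its order divides both 2 and the odd number `p`, so the orbit sum is `p * c`.
    have h1 : a (rotation (nOf p)) = 1 := by
      obtain ⟨k, hk⟩ := (Fact.out : p.Prime).odd_of_ne_two hp
      have e : nOf p = 2 * k + 1 := hodd.trans hk
      have hn' : a (rotation (nOf p)) ^ (2 * k + 1) = 1 := by rw [← e]; exact hn
      rwa [pow_succ, pow_mul, h2, one_pow, one_mul] at hn'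
    have h (k : ℕ) : (a (rotation (nOf p)))^[k] c = c := by
      rw [h1]; exact Function.iterate_fixed rfl k
    simp only [h, sum_const, card_range, hodd, nsmul_eq_mul, CharP.cast_eq_zero, zero_mul]

end fieldAction

end CycleIdeal

theorem ZMod.induction_add_one {n : ℕ} [NeZero n] {P : ZMod n → Prop} (h0 : P 0)
    (h : ∀ i, P i → P (i + 1)) (i : ZMod n) : P i := by
  have (k : ℕ) : P k := by
    induction k with
    | zero => simpa using h0
    | succ k ih => simpa using h _ ih
  simpa using this i.val

namespace CycleIdeal

theorem sub_one_ne_self {n : ℕ} [h : Fact (2 < n)] (i : ZMod n) : i - 1 ≠ i := by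
  have : Fact (1 < n) := ⟨by have := h.out; omega⟩
  simp

theorem sub_one_ne_add_one {n : ℕ} [h : Fact (2 < n)] (i : ZMod n) : i - 1 ≠ i + 1 := by
  intro h'
  have h2 : ((2 : ℕ) : ZMod n) = 0 := by
    push_cast
    linear_combination -h'
  rw [ZMod.natCast_eq_zero_iff] at h2
  have := Nat.le_of_dvd two_pos h2
  have := h.out
  omega

variable {n : ℕ} [NeZero n]

/-! ### The generators of the ideal -/

/-- The generators `m₀` and `mᵢ`. -/
noncomputable def gen (n : ℕ) [NeZero n] : Option (ZMod n) → Var n →₀ ℕ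
  | none => m₀ n
  | some i => mᵢ n i

/-- The monomial `v_i e_{i-1,i}`. -/
noncomputable def left (i : ZMod n) : Var n →₀ ℕ :=
  Finsupp.single (Var.v i) 1 + Finsupp.single (Var.e (i - 1)) 1

/-- The monomial `v_i e_{i,i+1}`. -/
noncomputable def right (i : ZMod n) : Var n →₀ ℕ :=
  Finsupp.single (Var.v i) 1 + Finsupp.single (Var.e i) 1

/-- The monomial `v_i e_{i-1,i} e_{i,i+1}`. -/
noncomputable def spoke (i : ZMod n) : Var n →₀ ℕ :=
  left i + Finsupp.single (Var.e i) 1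

/-- The monomial `v₀²`. -/
noncomputable def center (n : ℕ) : Var n →₀ ℕ := Finsupp.single Var.v₀ 2

@[simp]
theorem gen_none_v₀ : gen n none .v₀ = 0 := by simp [gen, m₀, m]

@[simp]
theorem gen_none_v (j : ZMod n) : gen n none (.v j) = 1 := by simp [gen, m₀, m]

@[simp]
theorem gen_none_e (j : ZMod n) : gen n none (.e j) = 1 := by simp [gen, m₀, m]

@[simp]
theorem gen_some_v₀ (i : ZMod n) : gen n (some i) .v₀ = 2 := by simp [gen, mᵢ, m]

open Classical in
@[simp]
theorem gen_some_v (i j : ZMod n) : gen n (some i) (.v j) = if i = j then 0 else 1 := by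
  simp only [gen, mᵢ, m, Finsupp.tsub_apply, Finsupp.add_apply, Finsupp.single_apply,
    Finsupp.equivFunOnFinite_symm_apply_apply, reduceCtorEq, Var.v.injEq, if_false]
  split_ifs <;> rfl

open Classical in
@[simp]
theorem gen_some_e (i j : ZMod n) :
    gen n (some i) (.e j) = if i - 1 = j ∨ i = j then 0 else 1 := by
  simp only [gen, mᵢ, m, Finsupp.tsub_apply, Finsupp.add_apply, Finsupp.single_apply,
    Finsupp.equivFunOnFinite_symm_apply_apply, reduceCtorEq, Var.e.injEq, if_false]
  split_ifs <;> simp_all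

theorem gen_le_gen_iff {i j : Option (ZMod n)} : gen n i ≤ gen n j ↔ i = j := by
  refine ⟨fun h => ?_, fun h => h ▸ le_rfl⟩
  rcases i with _ | i <;> rcases j with _ | j
  · rfl
  · simpa using h (.v j)
  · simpa using h .v₀
  · have := h (.v j)
    by_contra hij
    simp_all

/-- Both sides are the least common multiple of `mᵢ` and `mᵢ₊₁`. -/
theorem gen_add_left [Fact (2 < n)] (i : ZMod n) :
    gen n (some i) + left i = gen n (some (i + 1)) + right (i + 1) := by
  classical
  ext x
  rcases x with _ | j | j
  · simp [left, right]
  · simp only [left, right, Finsupp.add_apply, gen_some_v, Finsupp.single_apply, reduceCtorEq,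
      Var.v.injEq, if_false]
    split_ifs <;> simp_all
  · have := sub_one_ne_self i
    simp only [left, right, Finsupp.add_apply, gen_some_e, Finsupp.single_apply, reduceCtorEq,
      Var.e.injEq, if_false, add_sub_cancel_right]
    by_cases h1 : i - 1 = j <;> by_cases h2 : i = j <;> by_cases h3 : i + 1 = j <;> simp_all

/-- Both sides are `v₀ m`. -/
theorem gen_add_spoke [Fact (2 < n)] (i : ZMod n) :
    gen n none + center n = gen n (some i) + spoke i := by
  classical
  ext x
  rcases x with _ | j | j
  · simp [left, center, spoke]
  · simp only [left, center, spoke, Finsupp.add_apply, gen_some_v, gen_none_v,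
      Finsupp.single_apply, reduceCtorEq, Var.v.injEq, if_false]
    split_ifs <;> simp_all
  · have := sub_one_ne_self i
    simp only [left, center, spoke, Finsupp.add_apply, gen_some_e, gen_none_e,
      Finsupp.single_apply, reduceCtorEq, Var.e.injEq, if_false]
    by_cases h1 : i - 1 = j <;> by_cases h2 : i = j <;> simp_all

/-- Here `n > 2` matters: for `n = 2` the two generators would both omit `e_{i-1,i}`. -/
theorem gen_add_left_le [Fact (2 < n)] {i : ZMod n} {u : Var n →₀ ℕ} (h : gen n (some i) ≤ u)
    (h' : gen n (some (i + 1)) ≤ u) : gen n (some i) + left i ≤ u := by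
  classical
  have := sub_one_ne_self i
  intro x
  rcases x with _ | j | j
  · simpa [left] using h .v₀
  · have h1 := h (.v j)
    have h2 := h' (.v j)
    simp only [left, Finsupp.add_apply, gen_some_v, Finsupp.single_apply, reduceCtorEq,
      Var.v.injEq, if_false] at *
    by_cases h1 : i = j <;> simp_all
  · have h1 := h (.e j)
    have h2 := h' (.e j)
    simp only [left, Finsupp.add_apply, gen_some_e, Finsupp.single_apply, reduceCtorEq,
      Var.e.injEq, if_false, add_sub_cancel_right] at *
    by_cases h3 : i - 1 = j <;> by_cases h4 : i = j <;> by_cases h5 : i + 1 = j <;> simp_all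
    subst h5
    exact (sub_one_ne_add_one i h3).elim

theorem gen_none_add_center_le {i : ZMod n} {u : Var n →₀ ℕ} (h : gen n none ≤ u)
    (h' : gen n (some i) ≤ u) : gen n none + center n ≤ u := by
  intro x
  rcases x with _ | j | j
  · simpa [center] using h' .v₀
  · simpa [center] using h (.v j)
  · simpa [center] using h (.e j)

/-- Two generators `mᵢ`, `mⱼ` with `i`, `j` distinct and not adjacent have least common multiple
`v₀ m`. -/
theorem adjacent_or_gen_none_add_center_le {i j : ZMod n} {u : Var n →₀ ℕ} (hij : i ≠ j)
    (h : gen n (some i) ≤ u) (h' : gen n (some j) ≤ u) :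
    j = i + 1 ∨ i = j + 1 ∨ gen n none + center n ≤ u := by
  classical
  by_contra! hc
  refine hc.2.2 fun x => ?_
  rcases x with _ | k | k
  · simpa [center] using h .v₀
  · have h1 := h (.v k)
    have h2 := h' (.v k)
    simp only [center, Finsupp.add_apply, gen_some_v, gen_none_v, Finsupp.single_apply,
      reduceCtorEq, if_false] at *
    by_cases h3 : i = k
    · subst h3
      simpa [hij.symm] using h2
    · simpa [h3] using h1
  · have h1 := h (.e k)
    have h2 := h' (.e k)
    simp only [center, Finsupp.add_apply, gen_some_e, gen_none_e, Finsupp.single_apply,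
      reduceCtorEq, if_false] at *
    by_cases h3 : i - 1 = k ∨ i = k
    · have h4 : ¬ (j - 1 = k ∨ j = k) := by
        rintro (rfl | rfl) <;> rcases h3 with h3 | h3
        · exact hij (sub_left_injective h3)
        · exact hc.1 (by rw [h3]; ring)
        · exact hc.2.1 (by rw [← h3]; ring)
        · exact hij h3
      simpa [h4] using h2
    · simpa [h3] using h1

theorem gen_some_le_of_gen_none_add_center_le [Fact (2 < n)] {u : Var n →₀ ℕ}
    (h : gen n none + center n ≤ u) (i : ZMod n) : gen n (some i) ≤ u :=
  le_trans (by rw [gen_add_spoke i]; exact le_self_add) h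

end CycleIdeal

namespace MvPolynomial

/-- A factor from the ideal of the origin passes into the coefficients. -/
theorem exists_sum_eq_of_mem_smul_top {X R ι M : Type*} [CommRing R] [Fintype ι]
    [AddCommGroup M] [Module (MvPolynomial X R) M]
    {F : ι → M} {r : MvPolynomial X R}
    (hr : ∀ x, r • x ∈ Submodule.span (MvPolynomial X R) (Set.range F)) {x : M}
    (hx : x ∈ Ideal.span (Set.range (MvPolynomial.X : X → MvPolynomial X R)) •
      (⊤ : Submodule (MvPolynomial X R) M)) :
    ∃ a : ι → MvPolynomial X R, (∀ k, constantCoeff (a k) = 0) ∧ r • x = ∑ k, a k • F k := by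
  induction hx using Submodule.smul_induction_on' with
  | smul s hs y _ =>
    obtain ⟨a, ha⟩ := (Submodule.mem_span_range_iff_exists_fun (MvPolynomial X R)).1 (hr y)
    rw [mem_span_range_X_iff] at hs
    refine ⟨fun k => s * a k, fun k => by simp [hs], ?_⟩
    rw [smul_comm, ← ha, Finset.smul_sum]
    simp only [mul_smul]
  | add x _ y _ hx hy =>
    obtain ⟨a, ha, hx⟩ := hx
    obtain ⟨b, hb, hy⟩ := hy
    exact ⟨a + b, fun k => by simp [ha, hb], by simp [smul_add, hx, hy, add_smul, sum_add_distrib]⟩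

end MvPolynomial

namespace CycleIdeal

open MvPolynomial

variable {n : ℕ} [NeZero n] {K : Type*} [Field K]

/-! ### Syzygies of the generators -/

/-- The generators dividing `u` can be joined through the given syzygies. Two of them that are not
adjacent on the cycle have least common multiple `v₀ m`; then every generator divides `u`, and one
can walk around the cycle and along the single spoke. -/
theorem monomial_smul_eq_of_gen_le [Fact (2 < n)] {Q : Type*} [AddCommGroup Q]
    [Module (MvPolynomial (Var n) K) Q] {B : Option (ZMod n) → Q}
    (hB : ∀ i, monomial (left i) (1 : K) • B (some i) =
      monomial (right (i + 1)) (1 : K) • B (some (i + 1)))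
    (hc : monomial (center n) (1 : K) • B none = monomial (spoke (0 : ZMod n)) (1 : K) • B (some 0))
    {u : Var n →₀ ℕ} {j j' : Option (ZMod n)} (hj : gen n j ≤ u) (hj' : gen n j' ≤ u) :
    monomial (u - gen n j) (1 : K) • B j = monomial (u - gen n j') (1 : K) • B j' := by
  have step (i : ZMod n) (h : gen n (some i) ≤ u) (h' : gen n (some (i + 1)) ≤ u) :
      monomial (u - gen n (some i)) (1 : K) • B (some i) =
        monomial (u - gen n (some (i + 1))) (1 : K) • B (some (i + 1)) := by
    obtain ⟨w, rfl⟩ := exists_add_of_le (gen_add_left_le h h')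
    have e1 : gen n (some i) + left i + w - gen n (some i) = w + left i := by
      rw [add_assoc, add_tsub_cancel_left, add_comm]
    have e2 : gen n (some i) + left i + w - gen n (some (i + 1)) = w + right (i + 1) := by
      rw [gen_add_left, add_assoc, add_tsub_cancel_left, add_comm]
    rw [e1, e2, ← one_mul (1 : K), ← monomial_mul, ← monomial_mul, mul_smul, mul_smul, hB]
  have full (h : gen n none + center n ≤ u) (i : ZMod n) :
      monomial (u - gen n (some i)) (1 : K) • B (some i) =
        monomial (u - gen n none) (1 : K) • B none := by
    induction i using ZMod.induction_add_one with
    | h0 =>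
      obtain ⟨w, rfl⟩ := exists_add_of_le h
      have e1 : gen n none + center n + w - gen n none = w + center n := by
        rw [add_assoc, add_tsub_cancel_left, add_comm]
      have e2 : gen n none + center n + w - gen n (some 0) = w + spoke 0 := by
        rw [gen_add_spoke 0, add_assoc, add_tsub_cancel_left, add_comm]
      rw [e1, e2, ← one_mul (1 : K), ← monomial_mul, ← monomial_mul, mul_smul, mul_smul,
        hc]
    | h i hi =>
      rw [← hi]
      exact (step i (gen_some_le_of_gen_none_add_center_le h i)
        (gen_some_le_of_gen_none_add_center_le h _)).symm
  rcases j with _ | i <;> rcases j' with _ | j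
  · rfl
  · exact (full (gen_none_add_center_le hj hj') j).symm
  · exact full (gen_none_add_center_le hj' hj) i
  · by_cases hij : i = j
    · rw [hij]
    · rcases adjacent_or_gen_none_add_center_le hij hj hj' with rfl | rfl | h
      · exact step i hj hj'
      · exact (step j hj' hj).symm
      · rw [full h i, full h j]

/-- The syzygies between adjacent generators, together with one that involves `m₀`, generate all
syzygies. -/
theorem sum_smul_eq_zero_of_syzygy [Fact (2 < n)] {Q : Type*} [AddCommGroup Q]
    [Module (MvPolynomial (Var n) K) Q] {B : Option (ZMod n) → Q}
    (hB : ∀ i, monomial (left i) (1 : K) • B (some i) =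
      monomial (right (i + 1)) (1 : K) • B (some (i + 1)))
    (hc : monomial (center n) (1 : K) • B none = monomial (spoke (0 : ZMod n)) (1 : K) • B (some 0))
    {r : Option (ZMod n) → MvPolynomial (Var n) K}
    (hr : ∑ j, r j * monomial (gen n j) 1 = 0) : ∑ j, r j • B j = 0 := by
  classical
  let _ : Module K Q := Module.compHom Q (C : K →+* MvPolynomial (Var n) K)
  have hC (a : K) (x : Q) : a • x = (C a : MvPolynomial (Var n) K) • x := rfl
  -- The choice of a generator dividing `u` is immaterial by `monomial_smul_eq_of_gen_le`. The value
  -- 0 outside the ideal plays no role, since `ψ` is applied only to multiples of generators.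
  let ψ : MvPolynomial (Var n) K →ₗ[K] Q := (basisMonomials (Var n) K).constr K fun u =>
    if h : ∃ j, gen n j ≤ u then monomial (u - gen n h.choose) (1 : K) • B h.choose else 0
  have hψ (j : Option (ZMod n)) (s : MvPolynomial (Var n) K) :
      ψ (s * monomial (gen n j) 1) = s • B j := by
    induction s using MvPolynomial.induction_on' with
    | monomial w a =>
      have e : (monomial w a * monomial (gen n j) 1 : MvPolynomial (Var n) K) =
          a • basisMonomials (Var n) K (w + gen n j) := by
        simp [smul_monomial, monomial_mul]
      have h : ∃ j', gen n j' ≤ w + gen n j := ⟨j, le_add_self⟩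
      rw [e, map_smul, Module.Basis.constr_basis, dif_pos h,
        monomial_smul_eq_of_gen_le hB hc h.choose_spec (le_add_self : gen n j ≤ w + gen n j),
        add_tsub_cancel_right, hC, ← mul_smul, C_mul_monomial, mul_one]
    | add p q hp hq => rw [add_mul, map_add, hp, hq, add_smul]
  rw [← map_zero ψ, ← hr, map_sum]
  exact Finset.sum_congr rfl fun j _ => (hψ j (r j)).symm

/-- No generator divides another, so only the `j`-th summand contributes. -/
theorem coeff_gen_sum (s : Option (ZMod n) → MvPolynomial (Var n) K) (j : Option (ZMod n)) :
    coeff (gen n j) (∑ k, s k * monomial (gen n k) 1) = constantCoeff (s j) := by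
  classical
  rw [coeff_sum, Finset.sum_eq_single j]
  · simp [coeff_mul_monomial', constantCoeff_eq]
  · intro k _ hk
    rw [coeff_mul_monomial', if_neg fun h => hk (gen_le_gen_iff.1 h)]
  · simp

/-! ### Presentations of the ideal -/

/-- The polynomial ring in the variables of the ideal. -/
noncomputable abbrev VarRing (n : ℕ) (K : Type*) [Field K] : Type _ := MvPolynomial (Var n) K

/-- The ideal generated by the variables. -/
noncomputable abbrev originIdeal (n : ℕ) (K : Type*) [Field K] : Ideal (VarRing n K) :=
  Ideal.span (Set.range (MvPolynomial.X : Var n → MvPolynomial (Var n) K))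

section presentation

variable {M₀ M₁ : Type*} [AddCommGroup M₀] [AddCommGroup M₁] [Module (VarRing n K) M₀]
  [Module (VarRing n K) M₁]

/-- Subtracting the combination of the `B k` with the same image leaves an element of the kernel,
which vanishes at the origin; Nakayama applies. -/
theorem exists_smul_mem_span_of_augmentation [Module.Finite (VarRing n K) M₀]
    {D : M₀ →ₗ[VarRing n K] VarRing n K}
    (hD : ∀ x, ∃ a : Option (ZMod n) → VarRing n K, D x = ∑ k, a k * monomial (gen n k) 1)
    (hker : ∀ x, D x = 0 → x ∈ originIdeal n K • (⊤ : Submodule (VarRing n K) M₀))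
    {B : Option (ZMod n) → M₀} (hB : ∀ j, D (B j) = monomial (gen n j) 1) :
    ∃ r : VarRing n K, constantCoeff r = 1 ∧ ∀ x,
      r • x ∈ Submodule.span (VarRing n K) (Set.range B) := by
  refine exists_smul_mem_of_le_sup _ fun x _ => ?_
  obtain ⟨a, ha⟩ := hD x
  rw [← sub_add_cancel x (∑ k, a k • B k), add_comm]
  refine Submodule.add_mem_sup (Submodule.sum_mem _ fun k _ =>
    Submodule.smul_mem _ _ (Submodule.subset_span ⟨k, rfl⟩)) (hker _ ?_)
  simp [ha, hB]

/-- The coefficient of `D x` at a generator is zero for `x` vanishing at the origin, and it reads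
off `c j` from a constant combination of the `B j`. -/
theorem linearIndependent_of_augmentation [Module.Finite (VarRing n K) M₀]
    [Module.Free (VarRing n K) M₀]
    {D : M₀ →ₗ[VarRing n K] VarRing n K}
    (hD : ∀ x, ∃ a : Option (ZMod n) → VarRing n K, D x = ∑ k, a k * monomial (gen n k) 1)
    {B : Option (ZMod n) → M₀} (hB : ∀ j, D (B j) = monomial (gen n j) 1) :
    LinearIndependent (VarRing n K) B := by
  refine linearIndependent_of_origin B fun c hc => funext fun j => ?_
  have key (x : M₀) (hx : x ∈ originIdeal n K • (⊤ : Submodule (VarRing n K) M₀)) :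
    coeff (gen n j) (D x) = 0 := by
    induction hx using Submodule.smul_induction_on' with
    | smul s hs y _ =>
      rw [mem_span_range_X_iff] at hs
      obtain ⟨a, ha⟩ := hD y
      rw [map_smul, ha, smul_eq_mul, Finset.mul_sum]
      simp only [← mul_assoc]
      rw [coeff_gen_sum (fun k => s * a k), map_mul, hs, zero_mul]
    | add x _ y _ hx hy => rw [map_add, coeff_add, hx, hy, add_zero]
  have := key _ hc
  simp only [map_sum, map_smul, hB, smul_eq_mul] at this
  rw [coeff_gen_sum (fun k => C (c k))] at this
  simpa using this

/-- `F` lifts the generating syzygies with respect to the lift `B` of the generators. -/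
structure IsSyzygyLift (d : M₁ →ₗ[VarRing n K] M₀) (B : Option (ZMod n) → M₀)
    (F : Option (ZMod n) → M₁) : Prop where
  map_some (i : ZMod n) : d (F (some i)) = monomial (left i) (1 : K) • B (some i) -
    monomial (right (i + 1)) (1 : K) • B (some (i + 1))
  map_none :
    d (F none) = monomial (center n) (1 : K) • B none -
      monomial (spoke (0 : ZMod n)) (1 : K) • B (some 0)

variable {d : M₁ →ₗ[VarRing n K] M₀} {B : Option (ZMod n) → M₀} {F : Option (ZMod n) → M₁}

/-- Nakayama again: modulo cycles and elements vanishing at the origin, `y` comes from the span of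
`F`, because the lifted syzygies generate all syzygies. -/
theorem exists_smul_mem_span_of_isSyzygyLift [Fact (2 < n)] [Module.Finite (VarRing n K) M₀]
    [Module.Finite (VarRing n K) M₁] {D : M₀ →ₗ[VarRing n K] VarRing n K}
    (hD : ∀ x, ∃ a : Option (ZMod n) → VarRing n K, D x = ∑ k, a k * monomial (gen n k) 1)
    (hker : ∀ x, D x = 0 → x ∈ originIdeal n K • (⊤ : Submodule (VarRing n K) M₀))
    (hDd : ∀ y, D (d y) = 0)
    (hker' : ∀ y, d y = 0 → y ∈ originIdeal n K • (⊤ : Submodule (VarRing n K) M₁))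
    (hB : ∀ j, D (B j) = monomial (gen n j) 1) (hF : IsSyzygyLift d B F) :
    ∃ r : VarRing n K, constantCoeff r = 1 ∧
      ∀ y, r • y ∈ Submodule.span (VarRing n K) (Set.range F) := by
  obtain ⟨r, hr, hrB⟩ := exists_smul_mem_span_of_augmentation hD hker hB
  refine exists_smul_mem_of_le_sup _ fun y _ => ?_
  obtain ⟨a, ha⟩ := (Submodule.mem_span_range_iff_exists_fun (VarRing n K)).1 (hrB (d y))
  -- In the quotient by `N` the generating syzygies hold for the images of the `B j`, hence so does
  -- every syzygy, in particular the one given by `a`.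
  let N := (Submodule.span (VarRing n K) (Set.range F)).map d
  have hFN (j : Option (ZMod n)) : d (F j) ∈ N :=
    Submodule.mem_map_of_mem (Submodule.subset_span ⟨j, rfl⟩)
  have h0 : ∑ j, a j • N.mkQ (B j) = 0 := by
    refine sum_smul_eq_zero_of_syzygy (B := fun j => N.mkQ (B j)) (fun i => ?_) ?_ ?_
    · rw [← sub_eq_zero, ← map_smul, ← map_smul, ← map_sub, ← hF.map_some]
      exact (Submodule.Quotient.mk_eq_zero N).2 (hFN _)
    · rw [← sub_eq_zero, ← map_smul, ← map_smul, ← map_sub, ← hF.map_none]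
      exact (Submodule.Quotient.mk_eq_zero N).2 (hFN _)
    · have := congrArg D ha
      simpa [hB, hDd] using this
  have h1 : r • d y ∈ N := by
    rw [← ha, ← Submodule.Quotient.mk_eq_zero N]
    rw [← h0, ← Submodule.mkQ_apply, map_sum]
    simp only [map_smul]
  obtain ⟨z, hz, hzy⟩ := h1
  -- The second term is a cycle, and `1 - r` vanishes at the origin.
  have e : y = z + ((r • y - z) + (1 - r) • y) := by rw [sub_smul, one_smul]; abel
  rw [e]
  refine Submodule.add_mem_sup hz (add_mem (hker' _ ?_) (Submodule.smul_mem_smul ?_ trivial))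
  · rw [map_sub, map_smul, hzy, sub_self]
  · rw [mem_span_range_X_iff, map_sub, hr, map_one, sub_self]

/-- All relations between the lifted syzygies become trivial under `d` except for the multiples of
`∑ e_i f_i`. -/
theorem exists_eq_mul_X_of_map_sum_eq_zero [Fact (2 < n)] (hB : LinearIndependent (VarRing n K) B)
    (hF : IsSyzygyLift d B F) {a : Option (ZMod n) → VarRing n K} (ha : d (∑ j, a j • F j) = 0) :
    a none = 0 ∧ ∃ t : VarRing n K, ∀ i, a (some i) = t * X (Var.e i) := by
  classical
  -- The coefficients of the image in terms of the `B j`: each `F (some i)` contributes at `i` and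
  -- `i + 1`, and `F none` at `none` and `0`.
  let co : Option (ZMod n) → VarRing n K
    | none => a none * monomial (center n) 1
    | some i => a (some i) * monomial (left i) 1 - a (some (i - 1)) * monomial (right i) 1 -
        if i = 0 then a none * monomial (spoke (0 : ZMod n)) 1 else 0
  have hco : ∑ j, co j • B j = 0 := by
    rw [← ha, map_sum, Fintype.sum_option, Fintype.sum_option, map_smul, hF.map_none]
    simp only [map_smul, hF.map_some, co, sub_smul, smul_sub, ite_smul, zero_smul, sum_sub_distrib,
      sum_ite_eq', mem_univ, if_true, mul_smul]
    rw [← Equiv.sum_comp (Equiv.addRight (1 : ZMod n)) fun i =>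
      a (some (i - 1)) • (monomial (right i)) (1 : K) • B (some i)]
    simp only [Equiv.coe_addRight, add_sub_cancel_right]
    abel
  have h0 := Fintype.linearIndependent_iff.1 hB co hco
  have hnone : a none = 0 := by
    have := h0 none
    simpa [co] using this
  refine ⟨hnone, ?_⟩
  have hrel (i : ZMod n) :
      a (some i) * X (Var.e (i - 1)) = a (some (i - 1)) * (X (Var.e i) : VarRing n K) := by
    have := h0 (some i)
    simp only [co, hnone, zero_mul, ite_self, sub_zero, left, right] at this
    rw [← one_mul (1 : K), ← monomial_mul, ← monomial_mul] at this
    have hX : (X (Var.v i) : VarRing n K) ≠ 0 := X_ne_zero _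
    refine mul_left_cancel₀ hX ?_
    change a (some i) * (X (Var.v i) * X (Var.e (i - 1))) -
      a (some (i - 1)) * (X (Var.v i) * X (Var.e i)) = 0 at this
    linear_combination this
  have hdvd (i : ZMod n) : (X (Var.e i) : VarRing n K) ∣ a (some i) := by
    have h : (X (Var.e i) : VarRing n K) ∣ a (some i) * X (Var.e (i - 1)) := by
      rw [hrel]; exact dvd_mul_left _ _
    refine (X_prime.dvd_or_dvd h).resolve_right (X_dvd_X.not.2 fun h' => ?_)
    exact sub_one_ne_self i (Var.e.inj h').symm
  choose t ht using hdvd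
  refine ⟨t 0, fun i => ?_⟩
  suffices t i = t 0 by rw [ht, this, mul_comm]
  induction i using ZMod.induction_add_one with
  | h0 => rfl
  | h i hi =>
  rw [← hi]
  have h := hrel (i + 1)
  rw [add_sub_cancel_right, ht, ht i] at h
  have hX : (X (Var.e i) * X (Var.e (i + 1)) : VarRing n K) ≠ 0 :=
    mul_ne_zero (X_ne_zero _) (X_ne_zero _)
  refine mul_left_cancel₀ hX ?_
  linear_combination h

/-- The element `∑ e_i f_i`, which generates the second syzygies near the origin. -/
noncomputable def edgeSum (K : Type*) [Field K] {M₁ : Type*} [AddCommGroup M₁]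
    [Module (MvPolynomial (Var n) K) M₁] (F : Option (ZMod n) → M₁) : M₁ :=
  ∑ i, (X (Var.e i) : MvPolynomial (Var n) K) • F (some i)

theorem exists_smul_eq_smul_edgeSum [Fact (2 < n)] (hB : LinearIndependent (VarRing n K) B)
    (hF : IsSyzygyLift d B F) {r : VarRing n K}
    (hr : ∀ y, r • y ∈ Submodule.span (VarRing n K) (Set.range F)) {y : M₁}
    (hy : d y = 0) : ∃ t : VarRing n K, r • y = t • edgeSum K F := by
  obtain ⟨a, ha⟩ := (Submodule.mem_span_range_iff_exists_fun (VarRing n K)).1 (hr y)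
  obtain ⟨hnone, t, ht⟩ := exists_eq_mul_X_of_map_sum_eq_zero hB hF
    (a := a) (by rw [ha, map_smul, hy, smul_zero])
  refine ⟨t, ?_⟩
  rw [← ha, Fintype.sum_option, hnone, zero_smul, zero_add, edgeSum, Finset.smul_sum]
  simp only [ht, mul_smul]

/-- If the sum were zero, its `e_0`-coefficients would force `F (some 0)` to vanish at the origin.
Then `r • F (some 0)` has a second expression with coefficients vanishing there; the difference is a
relation whose coefficient at `some 0` is 1 at the origin but also divisible by `e_0`. -/
theorem edgeSum_ne_zero [Fact (2 < n)] [Module.Free (VarRing n K) M₁]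
    (hB : LinearIndependent (VarRing n K) B)
    (hF : IsSyzygyLift d B F) {r : VarRing n K} (hr1 : constantCoeff r = 1)
    (hr : ∀ y, r • y ∈ Submodule.span (VarRing n K) (Set.range F)) : edgeSum K F ≠ 0 := by
  classical
  intro hq
  have hmem : F (some 0) ∈ originIdeal n K • (⊤ : Submodule (VarRing n K) M₁) := by
    let b := Module.Free.chooseBasis (VarRing n K) M₁
    rw [← b.linearCombination_repr (F (some 0)), Finsupp.linearCombination_apply]
    refine Submodule.sum_mem _ fun k _ => Submodule.smul_mem_smul ?_ trivial
    rw [mem_span_range_X_iff]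
    have h := congrArg (fun y => coeff (Finsupp.single (Var.e (0 : ZMod n)) 1) (b.repr y k)) hq
    simp only [edgeSum, map_sum, map_smul, Finsupp.coe_finsetSum, Finset.sum_apply,
      Finsupp.smul_apply, smul_eq_mul, coeff_sum, coeff_X_mul', map_zero, Finsupp.coe_zero,
      Pi.zero_apply, coeff_zero] at h
    rw [Finset.sum_eq_single 0] at h
    · simpa [constantCoeff_eq] using h
    · intro i _ hi
      rw [if_neg]
      rw [Finsupp.mem_support_iff, Finsupp.single_apply, if_neg fun h' => hi (Var.e.inj h').symm]
      exact not_not_intro rfl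
    · simp
  obtain ⟨a, ha, hra⟩ := exists_sum_eq_of_mem_smul_top hr hmem
  obtain ⟨-, t, ht⟩ := exists_eq_mul_X_of_map_sum_eq_zero hB hF
    (a := Pi.single (some 0) r - a) (by
      have :
        ∑ j, (Pi.single (some (0 : ZMod n)) r - a : Option (ZMod n) → VarRing n K) j • F j = 0 := by
        simp only [Pi.sub_apply, sub_smul, sum_sub_distrib, ← hra]
        rw [Finset.sum_eq_single (some 0)] <;> simp +contextual
      rw [this, map_zero])
  have := congrArg constantCoeff (ht 0)
  simp [hr1, ha] at this

end presentation

end CycleIdeal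

namespace CycleIdeal

open MvPolynomial

variable {n : ℕ} [NeZero n] {K : Type*} [Field K]

/-! ### The action of the rotation -/

theorem mapDomain_rotationPerm_gen_none : (gen n none).mapDomain (rotationPerm n) = gen n none := by
  rw [gen, m₀, mapDomain_tsub, mapDomain_m, Finsupp.mapDomain_single]
  rfl

theorem mapDomain_rotationPerm_gen_some (i : ZMod n) :
    (gen n (some i)).mapDomain (rotationPerm n) = gen n (some (i + 1)) := by
  simp only [gen, mᵢ, mapDomain_tsub, Finsupp.mapDomain_add, mapDomain_m, Finsupp.mapDomain_single]
  simp [rotationPerm]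

theorem mapDomain_rotationPerm_left {n : ℕ} (i : ZMod n) :
    (left i).mapDomain (rotationPerm n) = left (i + 1) := by
  simp [left, Finsupp.mapDomain_add, rotationPerm]

theorem mapDomain_rotationPerm_right {n : ℕ} (i : ZMod n) :
    (right i).mapDomain (rotationPerm n) = right (i + 1) := by
  simp [right, Finsupp.mapDomain_add, rotationPerm]

theorem mapDomain_rotationPerm_spoke {n : ℕ} (i : ZMod n) :
    (spoke i).mapDomain (rotationPerm n) = spoke (i + 1) := by
  rw [spoke, Finsupp.mapDomain_add, mapDomain_rotationPerm_left, Finsupp.mapDomain_single]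
  rfl

theorem mapDomain_rotationPerm_center {n : ℕ} : (center n).mapDomain (rotationPerm n) = center n :=
    by
  simp [center, rotationPerm]

/-- The family `x, x₀, S x₀, S² x₀, …`. -/
def orbitFamily {n : ℕ} {M : Type*} (S : M → M) (x x₀ : M) : Option (ZMod n) → M
  | none => x
  | some i => S^[i.val] x₀

theorem orbitFamily_some_zero {n : ℕ} {M : Type*} (S : M → M) (x x₀ : M) :
    orbitFamily S x x₀ (some (0 : ZMod n)) = x₀ := by
  simp [orbitFamily]

/-- Periodicity is needed exactly at the wrap-around from `n - 1` to `0`. -/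
theorem orbitFamily_some_add_one {M : Type*} {S : M → M} (hS : ∀ x, S^[n] x = x) (x x₀ : M)
    (i : ZMod n) : orbitFamily S x x₀ (some (i + 1)) = S (orbitFamily S x x₀ (some i)) :=
  Function.IsPeriodicPt.iterate_zmod_val_add_one (hS x₀) i

theorem iterate_smul {A M : Type*} [Semiring A] [AddCommMonoid M] [Module A M] {τ : A → A}
    {S : M → M} (h : ∀ r x, S (r • x) = τ r • S x) (k : ℕ) (r : A) (x : M) :
    S^[k] (r • x) = τ^[k] r • S^[k] x := by
  induction k with
  | zero => rfl
  | succ k ih => simp only [Function.iterate_succ_apply', ih, h]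

/-- The sum of an element over the orbit of a periodic endomorphism. -/
def orbitSum {M : Type*} [AddCommGroup M] (S : M →+ M) (n : ℕ) : M →+ M where
  toFun x := ∑ k ∈ range n, S^[k] x
  map_zero' := by simp
  map_add' x y := by simp [sum_add_distrib]

theorem orbitSum_sub {M : Type*} [AddCommGroup M] {S : M →+ M} {n : ℕ}
    (hS : ∀ x, S^[n] x = x) (x : M) : orbitSum S n (S x - x) = 0 := by
  change ∑ k ∈ range n, S^[k] (S x - x) = 0
  have h (k : ℕ) : S^[k] (S x - x) = S^[k + 1] x - S^[k] x := by
    rw [iterate_map_sub, Function.iterate_succ_apply]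
  simp only [h]
  rw [sum_range_sub fun k => S^[k] x, hS, Function.iterate_zero_apply, sub_self]

theorem map_orbitSum {M N : Type*} [AddCommGroup M] [AddCommGroup N] {d : M →+ N} {S₁ : M →+ M}
    {S₀ : N →+ N} (hd : ∀ y, d (S₁ y) = S₀ (d y)) (k : ℕ) (y : M) :
    d (orbitSum S₁ k y) = orbitSum S₀ k (d y) := by
  change d (∑ k ∈ range k, S₁^[k] y) = ∑ k ∈ range k, S₀^[k] (d y)
  rw [map_sum]
  exact Finset.sum_congr rfl fun j _ => Function.Semiconj.iterate_right hd j y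

theorem iterate_constantCoeff {X A : Type*} [CommSemiring A]
    {τ : MvPolynomial X A →+* MvPolynomial X A} {α : A → A}
    (hτ : ∀ r, constantCoeff (τ r) = α (constantCoeff r)) (k : ℕ) (r : MvPolynomial X A) :
    constantCoeff (τ^[k] r) = α^[k] (constantCoeff r) :=
  Function.Semiconj.iterate_right (f := constantCoeff) hτ k r

section presentation

variable {M₀ M₁ : Type*} [AddCommGroup M₀] [AddCommGroup M₁] [Module (VarRing n K) M₀]
  [Module (VarRing n K) M₁]

/-- A minimal presentation of the ideal does not admit a lift of the rotation whose `n`-th power is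
the identity, when the orbit sums of the action on the field vanish. -/
theorem not_exists_equivariant_presentation [Fact (2 < n)] [Module.Finite (VarRing n K) M₀]
    [Module.Free (VarRing n K) M₀] [Module.Finite (VarRing n K) M₁]
    [Module.Free (VarRing n K) M₁] {D : M₀ →ₗ[VarRing n K] VarRing n K}
    {d : M₁ →ₗ[VarRing n K] M₀}
    (hD : ∀ x, ∃ a : Option (ZMod n) → VarRing n K, D x = ∑ k, a k * monomial (gen n k) 1)
    (hgen : ∀ j, ∃ x, D x = monomial (gen n j) 1)
    (hker : ∀ x, D x = 0 → ∃ y, d y = x) (hDd : ∀ y, D (d y) = 0)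
    (hmin : ∀ y, d y ∈ originIdeal n K • (⊤ : Submodule (VarRing n K) M₀))
    (hker' : ∀ y, d y = 0 → y ∈ originIdeal n K • (⊤ : Submodule (VarRing n K) M₁))
    {τ : VarRing n K →+* VarRing n K} {α : K → K}
    (hτ : ∀ r, constantCoeff (τ r) = α (constantCoeff r))
    (hτm : ∀ u, τ (monomial u 1) = monomial (u.mapDomain (rotationPerm n)) 1)
    (hα : ∀ c, ∑ k ∈ range n, α^[k] c = 0)
    {S₀ : M₀ →+ M₀} {S₁ : M₁ →+ M₁} (hS₀ : ∀ r x, S₀ (r • x) = τ r • S₀ x)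
    (hS₁ : ∀ r y, S₁ (r • y) = τ r • S₁ y) (hd : ∀ y, d (S₁ y) = S₀ (d y))
    (hDS : ∀ x, D (S₀ x) = τ (D x)) (hS₀n : ∀ x, S₀^[n] x = x) (hS₁n : ∀ y, S₁^[n] y = y) :
    False := by
  classical
  obtain ⟨c, hc⟩ := hgen none
  obtain ⟨b, hb⟩ := hgen (some 0)
  -- The `mᵢ` lift to a single orbit, whereas the lift `c` of `m₀` need not be fixed by `S₀`.
  let B : Option (ZMod n) → M₀ := orbitFamily S₀ c b
  have hBS (i : ZMod n) : B (some (i + 1)) = S₀ (B (some i)) := orbitFamily_some_add_one hS₀n c b i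
  have hB (j : Option (ZMod n)) : D (B j) = monomial (gen n j) 1 := by
    rcases j with _ | i
    · exact hc
    · induction i using ZMod.induction_add_one with
      | h0 => rw [← hb]; exact congrArg D (orbitFamily_some_zero S₀ c b)
      | h i hi => rw [hBS, hDS, hi, hτm, mapDomain_rotationPerm_gen_some]
  have hker0 (x : M₀) (hx : D x = 0) : x ∈ originIdeal n K • (⊤ : Submodule (VarRing n K) M₀) := by
    obtain ⟨y, rfl⟩ := hker x hx
    exact hmin y
  have hind : LinearIndependent (VarRing n K) B := linearIndependent_of_augmentation hD hB
  obtain ⟨g, hg⟩ := hker (monomial (center n) (1 : K) • B none -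
      monomial (spoke (0 : ZMod n)) (1 : K) • B (some 0)) (by
    simp [hB, monomial_mul, add_comm (center n), add_comm (spoke (0 : ZMod n)), gen_add_spoke 0])
  obtain ⟨f, hf⟩ := hker (monomial (left (0 : ZMod n)) (1 : K) • B (some 0) -
      monomial (right (0 + 1 : ZMod n)) (1 : K) • B (some (0 + 1))) (by
    rw [map_sub, map_smul, map_smul, hB, hB, smul_eq_mul, smul_eq_mul, monomial_mul, monomial_mul,
      add_comm, gen_add_left, add_comm, sub_self])
  let F : Option (ZMod n) → M₁ := orbitFamily S₁ g f
  have hFS (i : ZMod n) : F (some (i + 1)) = S₁ (F (some i)) := orbitFamily_some_add_one hS₁n g f i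
  have hF0 : F (some 0) = f := orbitFamily_some_zero S₁ g f
  have hF : IsSyzygyLift d B F := by
    refine ⟨fun i => ?_, hg⟩
    induction i using ZMod.induction_add_one with
    | h0 => rw [hF0, hf]
    | h i hi =>
      rw [hFS, hd, hi, map_sub, hS₀, hS₀, hτm, hτm, ← hBS, ← hBS, mapDomain_rotationPerm_left,
        mapDomain_rotationPerm_right]
  obtain ⟨r, hr1, hr⟩ := exists_smul_mem_span_of_isSyzygyLift hD hker0 hDd hker' hB hF
  have hq0 : edgeSum K F ≠ 0 := edgeSum_ne_zero hind hF hr1 hr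
  have hqS : S₁ (edgeSum K F) = edgeSum K F := by
    simp only [edgeSum, map_sum, hS₁, ← hFS]
    rw [← Equiv.sum_comp (Equiv.addRight (1 : ZMod n)) fun i =>
      (X (Var.e i) : VarRing n K) • F (some i)]
    refine Finset.sum_congr rfl fun i _ => ?_
    rw [X, hτm, Finsupp.mapDomain_single]
    rfl
  have hqSk (k : ℕ) : S₁^[k] (edgeSum K F) = edgeSum K F := Function.iterate_fixed hqS k
  -- A multiple of `r` that is fixed by `τ` and does not vanish at the origin.
  let ρ : VarRing n K := ∏ k ∈ range n, τ^[k] r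
  -- `S₁^n = 1` is applied to a multiple of the fixed nonzero element `edgeSum K F` of a
  -- torsion-free module.
  have hτn : τ^[n] r = r := by
    have h := hS₁n (r • edgeSum K F)
    rw [iterate_smul hS₁, hqSk] at h
    exact smul_left_injective _ hq0 h
  have hρ : τ ρ = ρ := by
    have h := (prod_range_succ' (fun k => τ^[k] r) n).symm.trans
      (prod_range_succ (fun k => τ^[k] r) n)
    rw [hτn, Function.iterate_zero_apply] at h
    have hr0 : r ≠ 0 := by rintro rfl; simp at hr1
    rw [map_prod]
    simpa only [Function.iterate_succ_apply'] using mul_right_cancel₀ hr0 h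
  have hα1 : α 1 = 1 := by simpa using (hτ 1).symm
  have hρ1 : constantCoeff ρ = 1 := by
    rw [map_prod]
    refine Finset.prod_eq_one fun k _ => ?_
    rw [iterate_constantCoeff hτ, hr1]
    exact Function.iterate_fixed hα1 k
  have hρk (y : M₁) (hy : d y = 0) : ∃ t : VarRing n K, ρ • y = t • edgeSum K F := by
    obtain ⟨t, ht⟩ := exists_smul_eq_smul_edgeSum hind hF hr hy
    obtain ⟨s, hs⟩ := Finset.dvd_prod_of_mem (fun k => τ^[k] r) (mem_range.2 (NeZero.pos n))
    refine ⟨s * t, ?_⟩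
    change ρ = r * s at hs
    rw [hs, mul_comm r s, mul_smul, mul_smul, ht]
  -- The failure of `g` to be invariant.
  obtain ⟨y, hy⟩ := hker (S₀ c - c) (by
    rw [map_sub, hDS, hc, hτm, mapDomain_rotationPerm_gen_none, sub_self])
  -- Rotation moves the foot of the whisker from `m_0` on the cycle (index `0`) to index `1`. The
  -- edge `e_0 f` joins the two feet and `v₀² y` accounts for `S₀ c - c`, so the remainder is a
  -- cycle.
  let κ : M₁ := S₁ g - g - monomial (center n) (1 : K) • y - (X (Var.e 0) : VarRing n K) • f
  have hκ : d κ = 0 := by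
    have e1 : monomial (left (0 : ZMod n)) (1 : K) * X (Var.e 0) =
        monomial (spoke (0 : ZMod n)) (1 : K) := by
      rw [X, monomial_mul, mul_one]; rfl
    have e2 : monomial (right (0 + 1 : ZMod n)) (1 : K) * X (Var.e 0) =
        monomial (spoke (0 + 1 : ZMod n)) (1 : K) := by
      rw [X, monomial_mul, mul_one, right, spoke, left, add_sub_cancel_right, add_right_comm]
    have hSg : d (S₁ g) = monomial (center n) (1 : K) • S₀ c -
        monomial (spoke (0 + 1 : ZMod n)) (1 : K) • B (some (0 + 1)) := by
      rw [hd, hg, map_sub, hS₀, hS₀, hτm, hτm, ← hBS, mapDomain_rotationPerm_center,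
        mapDomain_rotationPerm_spoke]
      rfl
    have hc' : B none = c := rfl
    rw [map_sub, map_sub, map_sub, map_smul, map_smul, hSg, hg, hy, hf, hc', smul_sub, smul_sub,
      ← mul_smul, ← mul_smul, mul_comm (X _), mul_comm (X _), e1, e2]
    abel
  -- The orbit sum of `S₁ g - g` telescopes to zero, `v₀²` is invariant, and the rotates of `e_0 f`
  -- add up to `edgeSum K F`.
  have hsum : monomial (center n) (1 : K) • orbitSum S₁ n y + edgeSum K F + orbitSum S₁ n κ = 0 :=
    by
    have h1 : orbitSum S₁ n (monomial (center n) (1 : K) • y) =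
        monomial (center n) (1 : K) • orbitSum S₁ n y := by
      change ∑ k ∈ range n, S₁^[k] _ = _ • ∑ k ∈ range n, S₁^[k] y
      rw [Finset.smul_sum]
      refine Finset.sum_congr rfl fun k _ => ?_
      rw [iterate_smul hS₁, Function.iterate_fixed (by rw [hτm, mapDomain_rotationPerm_center])]
    have h2 : orbitSum S₁ n ((X (Var.e 0) : VarRing n K) • f) = edgeSum K F := by
      change ∑ k ∈ range n, S₁^[k] ((X (Var.e 0) : VarRing n K) • f) = _
      rw [edgeSum, ZMod.sum_eq_sum_range fun i : ZMod n => (X (Var.e i) : VarRing n K) • F (some i)]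
      refine Finset.sum_congr rfl fun k hk => ?_
      clear hk
      induction k with
      | zero => rw [Nat.cast_zero, hF0, Function.iterate_zero_apply]
      | succ k ih =>
        rw [Function.iterate_succ_apply', ih, hS₁, Nat.cast_succ, hFS, X, hτm,
          Finsupp.mapDomain_single]
        rfl
    rw [← h1, ← h2, ← map_add, ← map_add, ← orbitSum_sub hS₁n g]
    congr 1
    simp only [κ]
    abel
  obtain ⟨t, ht⟩ := hρk κ hκ
  -- The orbit sum of `y` is a cycle because that of `d y = S₀ c - c` telescopes.
  obtain ⟨w, hw⟩ := hρk (orbitSum S₁ n y) (by 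
    exact (map_orbitSum (d := d.toAddMonoidHom) hd n y).trans
      ((congrArg (orbitSum S₀ n) hy).trans (orbitSum_sub hS₀n c)))
  have hρκ : ρ • orbitSum S₁ n κ = (∑ k ∈ range n, τ^[k] t) • edgeSum K F := by
    change ρ • ∑ k ∈ range n, S₁^[k] κ = _
    rw [Finset.smul_sum, Finset.sum_smul]
    refine Finset.sum_congr rfl fun k _ => ?_
    have h := congrArg S₁^[k] ht
    rwa [iterate_smul hS₁, iterate_smul hS₁, hqSk, Function.iterate_fixed hρ] at h
  have hzero : (monomial (center n) (1 : K) * w + ρ + ∑ k ∈ range n, τ^[k] t) • edgeSum K F = 0 :=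
    by
    rw [add_smul, add_smul, mul_smul, ← hw, ← hρκ, smul_comm, ← smul_add, ← smul_add, hsum,
      smul_zero]
  -- At the origin `v₀²` vanishes, `ρ` is 1 and the orbit sum of `t` vanishes by `hα`, leaving `1 =
  -- 0`.
  have h := congrArg constantCoeff ((smul_eq_zero.1 hzero).resolve_right hq0)
  have hcenter : constantCoeff (monomial (center n) (1 : K)) = 0 := by
    rw [constantCoeff_monomial, if_neg]
    simp [center]
  simp only [map_add, map_mul, map_sum, map_zero, iterate_constantCoeff hτ, hα, hcenter, hρ1,
    zero_mul, zero_add, add_zero] at h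
  exact one_ne_zero h

end presentation

end CycleIdeal

/-! ### From equivariant resolutions to equivariant presentations -/

namespace CycleIdeal

open MvPolynomial

theorem constantCoeff_polyAut {X k K : Type*} [Field k] [Field K] [Algebra k K] (a : K ≃ₐ[k] K)
    (σ : Equiv.Perm X) (r : MvPolynomial X K) :
    constantCoeff (polyAut a σ r) = a (constantCoeff r) := by
  simp [polyAut, constantCoeff_rename]

theorem polyAut_monomial_one {X k K : Type*} [Field k] [Field K] [Algebra k K] (a : K ≃ₐ[k] K)
    (σ : Equiv.Perm X) (u : X →₀ ℕ) :
    polyAut a σ (monomial u 1) = monomial (u.mapDomain σ) 1 := by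
  simp [polyAut, rename_monomial]

theorem gen_mem_ideal {n : ℕ} [NeZero n] (j : Option (ZMod n)) : gen n j ∈ ideal n := by
  rcases j with _ | i
  · exact AddSemigroupIdeal.mem_closure_of_mem (Set.mem_insert _ _)
  · exact AddSemigroupIdeal.mem_closure_of_mem (Set.mem_insert_of_mem _ (Set.mem_range_self i))

theorem polyIdeal_ideal (n : ℕ) [NeZero n] (K : Type*) [Field K] :
    MonomialIdeal.polyIdeal (ideal n) K =
      Ideal.span (Set.range fun j => monomial (gen n j) (1 : K)) := by
  refine le_antisymm (Ideal.span_le.2 ?_) (Ideal.span_le.2 ?_)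
  · rintro _ ⟨u, hu, rfl⟩
    obtain ⟨w, z, hz, rfl⟩ := AddSemigroupIdeal.mem_closure''.1 hu
    obtain ⟨j, rfl⟩ : ∃ j, gen n j = z := by
      rcases hz with rfl | ⟨i, rfl⟩
      exacts [⟨none, rfl⟩, ⟨some i, rfl⟩]
    have h : monomial (w + gen n j) (1 : K) = monomial w 1 * monomial (gen n j) 1 := by
      rw [monomial_mul, one_mul]
    change monomial (w + gen n j) (1 : K) ∈ _
    rw [h]
    exact Ideal.mul_mem_left _ _ (Ideal.subset_span ⟨j, rfl⟩)
  · rintro _ ⟨j, rfl⟩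
    exact Ideal.subset_span ⟨gen n j, gen_mem_ideal j, rfl⟩

theorem two_lt_nOf (p : ℕ) [h : Fact p.Prime] : 2 < nOf p := by
  have := h.out.two_le
  unfold nOf
  split_ifs <;> omega

/-- A general `π` treats the full symmetry group and the cyclic group together: only an element of
order dividing `n` over the rotation is needed. -/
theorem isEmpty_equivariantMinimalResolution {p : ℕ} [Fact p.Prime] {K : Type u} [Field K]
    [Algebra (ZMod p) K] [Algebra.IsAlgebraic (ZMod p) K] {Γ : Type*} [Group Γ]
    (π : Γ →* MonomialIdeal.symmetryGroup (idealOf p)) (γ : Γ) (hγ : π γ = rotation (nOf p))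
    (hγn : γ ^ nOf p = 1)
    (a : MonomialIdeal.symmetryGroup (idealOf p) →* (K ≃ₐ[ZMod p] K)) :
    IsEmpty (EquivariantMinimalResolution.{w} (idealOf p) π (a.comp π)) := by
  refine ⟨fun S => ?_⟩
  have : Fact (2 < nOf p) := ⟨two_lt_nOf p⟩
  have := S.free
  have := S.finite
  -- The augmentation uses `δ`, the identification compatible with the action.
  let D : S.M.X 0 →ₗ[VarRing (nOf p) K] VarRing (nOf p) K :=
    (MonomialIdeal.polyIdeal (idealOf p) K).subtype ∘ₗ S.δ.toLinearMap ∘ₗ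
      (LinearMap.range (S.M.d 1 0).hom).mkQ
  have hD0 (x : S.M.X 0) : D x = 0 ↔ x ∈ LinearMap.range (S.M.d 1 0).hom := by
    change (S.δ (Submodule.Quotient.mk x) : MvPolynomial (Var (nOf p)) K) = 0 ↔ _
    rw [ZeroMemClass.coe_eq_zero, LinearEquiv.map_eq_zero_iff, Submodule.Quotient.mk_eq_zero]
  have hact (j k : ℕ) (x : S.M.X j) : (S.act γ j)^[k] x = S.act (γ ^ k) j x := by
    induction k with
    | zero => rw [pow_zero, S.act_one]; rfl
    | succ k ih => rw [Function.iterate_succ_apply', ih, pow_succ', S.act_mul]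
  refine not_exists_equivariant_presentation (n := nOf p) (K := K) (D := D)
    (d := (S.M.d 1 0).hom)
    (τ := (polyAut (a (rotation (nOf p))) (rotationPerm (nOf p)) : _ →+* _))
    (α := a (rotation (nOf p))) (S₀ := (S.act γ 0 : _ →+ _)) (S₁ := (S.act γ 1 : _ →+ _))
    ?_ ?_ (fun x hx => (hD0 x).1 hx) (fun y => (hD0 _).2 ⟨y, rfl⟩)
    (fun y => S.minimal 0 ⟨y, rfl⟩) ?_ (constantCoeff_polyAut _ _) (polyAut_monomial_one _ _)
    (sum_fieldAction_rotation a) ?_ ?_ ?_ ?_ ?_ ?_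
  · intro x
    have h : D x ∈ MonomialIdeal.polyIdeal (idealOf p) K := (S.δ (Submodule.Quotient.mk x)).2
    rw [polyIdeal_ideal, Ideal.mem_span_range_iff_exists_fun] at h
    obtain ⟨c, hc⟩ := h
    exact ⟨c, hc.symm⟩
  · intro j
    have h : monomial (gen (nOf p) j) (1 : K) ∈ MonomialIdeal.polyIdeal (idealOf p) K :=
      Ideal.subset_span ⟨_, gen_mem_ideal j, rfl⟩
    obtain ⟨x, hx⟩ := Submodule.Quotient.mk_surjective _ (S.δ.symm ⟨_, h⟩)
    refine ⟨x, ?_⟩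
    change (S.δ (Submodule.Quotient.mk x) : MvPolynomial (Var (nOf p)) K) = _
    rw [hx, LinearEquiv.apply_symm_apply]
  -- Cycles are boundaries from degree 2, so minimality puts them in the ideal of the origin times
  -- the module.
  · intro y hy
    obtain ⟨z, rfl⟩ := (S.exact 0 y).1 hy
    exact S.minimal 1 ⟨z, rfl⟩
  · intro r x
    have h := S.act_smul γ 0 r x
    rw [MonoidHom.comp_apply, hγ] at h
    exact h
  · intro r x
    have h := S.act_smul γ 1 r x
    rw [MonoidHom.comp_apply, hγ] at h
    exact h
  · intro y
    exact (S.act_comm γ 0 y).symm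
  · intro x
    have h := S.δ_equivariant γ x
    rw [MonoidHom.comp_apply, hγ] at h
    exact h
  · intro x
    exact (hact 0 _ x).trans (by rw [hγn, S.act_one])
  · intro x
    exact (hact 1 _ x).trans (by rw [hγn, S.act_one])

end CycleIdeal

theorem theoremT (p : ℕ) [Fact p.Prime] (K : Type u) [Field K] [Algebra (ZMod p) K]
    [Algebra.IsAlgebraic (ZMod p) K] :
    IsEmpty (SymmetricMinimalResolution.{w} (ZMod p) K (CycleIdeal.idealOf p)) ∧
      ∀ a : MonomialIdeal.symmetryGroup (CycleIdeal.idealOf p) →* (K ≃ₐ[ZMod p] K),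
        IsEmpty (EquivariantMinimalResolution.{w} (CycleIdeal.idealOf p)
          (Subgroup.zpowers (CycleIdeal.rotation (CycleIdeal.nOf p))).subtype
          (a.comp (Subgroup.zpowers (CycleIdeal.rotation (CycleIdeal.nOf p))).subtype)) := by
  refine ⟨⟨fun S => ?_⟩, fun a => ?_⟩
  · exact (CycleIdeal.isEmpty_equivariantMinimalResolution (MonoidHom.id _)
      (CycleIdeal.rotation (CycleIdeal.nOf p)) rfl (CycleIdeal.rotation_pow _)
      S.fieldAction).false S.resolution
  · exact CycleIdeal.isEmpty_equivariantMinimalResolution _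
      ⟨_, Subgroup.mem_zpowers (CycleIdeal.rotation (CycleIdeal.nOf p))⟩ rfl
      (Subtype.ext (CycleIdeal.rotation_pow _)) a
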